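/- Let $T$ be a text of length $n$ over an alphabet whose symbols are coded by natural numbers, with positions numbered from $0$; write $T[a..b)$ for the factor at positions $a,\dots,b-1$. Let $\mathrm{Bitlen}:\mathbb N\to\mathbb N$ be non-decreasing, and let $0\le i\le n$ be the current time ($i$ symbols already processed). *LPF and REP.* $\mathrm{LPF}[i]$ is the largest $\ell\le n-i$ such that $T[i..i+\ell)=T[y..y+\ell)$ for some $y<i$ (and $0$ if there is no such $y$); the longest previous factor is $w=T[i..i+\mathrm{LPF}[i])$. A previous occurrence of $w$ is an occurrence at a position $y<i$ (it may run over position $i$); its offset is $i-y-1$. A position $j$ is a rightmost equal-cost position $\mathrm{REP}(w)$ if $j$ is a previous occurrence of $w$ and $\mathrm{Bitlen}(i-j-1)=\mathrm{Bitlen}(r)$, where $r$ is the smallest offset of a previous occurrence of $w$; if $w$ has no previous occurrence, $\mathrm{REP}(w)=0$. *The multilayer suffix tree.* Let $B=\{\mathrm{Bitlen}(x): 0\le x\le n\}$ and $SW=\{\max\{j\le n:\mathrm{Bitlen}(j)\le b\}: b\in B\}$. For $\alpha\in SW$ let $lo_\alpha=\max(0,i-\alpha-1)$. The layer $\alpha$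 is grown online: with tracked suffix $T[i..k)$ it reads one more symbol, passing from $k$ to $k+1$, as long as $k<n$ and $T[i..k+1)$ is a factor of $T[lo_\alpha..k)$; let $e_\alpha$ be the value of $k$ at which this stops. It starts with $k=0$ at time $0$, and with $k=\max(e_\alpha,i+1)$ (for the old $e_\alpha$) when the time passes from $i$ to $i+1$. At time $i$ the layer is the implicit suffix tree of $T[lo_\alpha..e_\alpha)$, each edge label referring to an occurrence from a suffix that starts at a position in $[lo_\alpha,i)$, together with a reference to the locus of its tracked repeated suffix $T[i..e_\alpha)$, the factor pointed to by the layer. The multilayer suffix tree of $T[0..i+\mathrm{LPF}[i])$ at time $i$ consists of the layers $\alpha\in SW$, stored in the memory of a unit-cost random access machine (node records with edge label position, string depth, parent, suffix link and child list; layer records with window start and the reference to the tracked suffix). *Claim.* For every $\alpha\in SW$, $e_\alpha-i$ is the largest $\ell\le n-i$ such that $T[i..i+\ell)=T[y..y+\ell)$ for some $lo_\alpha\le y<i$ ($0$ if there is none). The largest layer is $n\in SW$, and it satisfies $e_n=i+\mathrm{LPF}[i]$. The multilayer suffix tree at time $i$ exists as a memory content, and it solves $\mathrm{REP}(\mathrm{LPF})$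 in constant time. More precisely, there are three machine programs *reset*, *visit*, *query* and a constant $C$, independent of the alphabet, $T$, $n$, $i$, $\mathrm{Bitlen}$ and the memory content, such that the following holds. At time $i$ the building process runs *reset* once, and then *visit* once for each layer, from the largest to the smallest; afterwards *query* is run. Every single one of these runs halts within $C$ steps and leaves the stored data structure unchanged (values are kept only in machine registers), and *query* returns a position $j$ that is a $\mathrm{REP}$ of the longest previous factor at $i$. Moreover $j$ comes from the smallest layer $\alpha$ whose pointed factor has length $\mathrm{LPF}[i]$: every smaller layer points to a strictly shorter factor, and, if $i>0$, $j\ge lo_\alpha$ and $j$ is a previous occurrence of $w$. -/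

import Mathlib

namespace MLST

/-! ### Texts, factors, previous occurrences -/

section Text

variable {A : Type*}

/-- The factor of `T` occupying the 0-based positions `a, a+1, …, b-1`. -/
def factor (T : List A) (a b : ℕ) : List A := (T.drop a).take (b - a)

/-- Positions before the current position `i` at which the word `w` occurs in `T`.
Such an occurrence may run over the current position (as in LZ77 and in the usual LPF array). -/
def prevPos (T : List A) (i : ℕ) (w : List A) : Set ℕ := {y | y < i ∧ w <+: T.drop y}

/-- Offsets, with respect to the first `i` symbols of the text, of the previous occurrences of `w`:
an occurrence at position `y` has offset `i - y - 1`. -/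
def prevOffset (T : List A) (i : ℕ) (w : List A) : Set ℕ :=
  {x | ∃ y ∈ prevPos T i w, x = i - y - 1}

/-- `j` is a rightmost equal-cost position of `w` at time `i`: if `w` has a previous occurrence then
`j` is a previous occurrence whose offset has the same codeword length as the smallest offset;
otherwise `j = 0`. -/
def IsREP (bitlen : ℕ → ℕ) (T : List A) (i : ℕ) (w : List A) (j : ℕ) : Prop :=
  ((prevOffset T i w).Nonempty →
    j ∈ prevPos T i w ∧ ∃ r, IsLeast (prevOffset T i w) r ∧ bitlen (i - j - 1) = bitlen r) ∧
  (prevOffset T i w = ∅ → j = 0)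

/-- Length of the longest factor starting at position `i` that also occurs at some position
`y` with `lo ≤ y < i` (it is `0` if there is no such `y`). -/
noncomputable def lpfFrom (T : List A) (lo i : ℕ) : ℕ :=
  sSup {l | i + l ≤ T.length ∧ ∃ y, lo ≤ y ∧ y < i ∧ factor T y (y + l) = factor T i (i + l)}

/-- The longest previous factor array `LPF[i]`. -/
noncomputable def lpf (T : List A) (i : ℕ) : ℕ := lpfFrom T 0 i

/-- The longest previous factor itself (the greedy phrase at position `i`). -/
noncomputable def lpfWord (T : List A) (i : ℕ) : List A := factor T i (i + lpf T i)

end Text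

/-! ### Layer sizes -/

/-- Codeword lengths of all possible offsets over a text of length `n`. -/
def bitlenValues (bitlen : ℕ → ℕ) (n : ℕ) : Finset ℕ := (Finset.range (n + 1)).image bitlen

/-- The set `SW` of layer sizes: for each codeword length `b`, the greatest `j ≤ n` whose codeword
has length at most `b`. -/
def layerSizes (bitlen : ℕ → ℕ) (n : ℕ) : Finset ℕ :=
  (bitlenValues bitlen n).image (fun b => Nat.findGreatest (fun j => bitlen j ≤ b) n)

/-- The layer sizes in increasing order. -/
def layerList (bitlen : ℕ → ℕ) (n : ℕ) : List ℕ := (layerSizes bitlen n).sort (· ≤ ·)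

/-! ### Online growth of a layer -/

section Layer

variable {A : Type*}

/-- First (0-based) position of the window of the layer of size `α` at time `i`.  In 1-based
inclusive notation this is the beginning of `T[i-α : i]`, cut at the beginning of the text. -/
def windowStart (α i : ℕ) : ℕ := i - α - 1

open Classical in
/-- Steps of the online suffix tree construction during which the tracked repeated suffix starts at
position `i`.  With window start `lo` and `k` symbols read, the tracked suffix is `T[i..k)`.  If it
stays repeated after the next symbol is appended, i.e. `T[i..k+1)` is already in the tree of
`T[lo..k)`, one more symbol is consumed; otherwise this was the last such step. -/
noncomputable def grow (T : List A) (lo i k : ℕ) : ℕ :=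
  if h : k < T.length ∧ factor T i (k + 1) <:+: factor T lo k then grow T lo i (k + 1) else k
termination_by T.length - k
decreasing_by omega

/-- Number of symbols that the layer of size `α` has consumed at time `i`, i.e. after the last
construction step whose tracked suffix starts at `i`.  From time `i` to time `i + 1` the window
slides, the tracked suffix loses its first symbol, and the layer goes on from where it stopped. -/
noncomputable def layerEnd (T : List A) (α : ℕ) : ℕ → ℕ
  | 0 => grow T (windowStart α 0) 0 0
  | i + 1 => grow T (windowStart α (i + 1)) (i + 1) (max (layerEnd T α i) (i + 1))

/-- The window content of the layer `α` at time `i`; the layer is its implicit suffix tree. -/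
noncomputable def layerText (T : List A) (α i : ℕ) : List A :=
  factor T (windowStart α i) (layerEnd T α i)

/-- The repeated suffix to which the layer `α` points at time `i`. -/
noncomputable def pointed (T : List A) (α i : ℕ) : List A := factor T i (layerEnd T α i)

end Layer

/-! ### Implicit suffix trees; a node is identified with the word spelled from the root to it -/

section SuffixTree

variable {A : Type*}

/-- `w` is a factor of `W` followed in `W` by two distinct symbols. -/
def IsBranching (W w : List A) : Prop :=
  ∃ c d : A, c ≠ d ∧ w ++ [c] <:+: W ∧ w ++ [d] <:+: W

/-- `w` is a leaf: a factor of `W` with no right extension, i.e. an unrepeated suffix. -/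
def IsLeaf (W w : List A) : Prop := w <:+: W ∧ ∀ c : A, ¬ (w ++ [c] <:+: W)

/-- Explicit nodes of the implicit suffix tree of `W`: root, branching nodes, leaves. -/
def IsNode (W w : List A) : Prop := w = [] ∨ IsBranching W w ∨ IsLeaf W w

/-- `v` is a child of `u`: both are explicit nodes, and `u` is the last one above `v`. -/
def IsChild (W u v : List A) : Prop :=
  IsNode W u ∧ IsNode W v ∧ u <+: v ∧ u ≠ v ∧
    ∀ x, IsNode W x → x <+: v → x ≠ v → x <+: u

end SuffixTree

/-! ### A random access machine with unit cost -/

/-- Instructions; operands are register numbers, except for the immediate operand of `const` and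
the target of `jle`. -/
inductive Instr where
  | const (d c : ℕ)
  | add (d a b : ℕ)
  | sub (d a b : ℕ)
  | load (d a : ℕ)
  | store (a b : ℕ)
  | jle (a b target : ℕ)

abbrev Program := List Instr

structure Config where
  pc : ℕ
  regs : ℕ → ℕ
  mem : ℕ → ℕ

/-- Effect of one instruction. -/
def Instr.exec : Instr → Config → Config
  | .const d c, s => ⟨s.pc + 1, Function.update s.regs d c, s.mem⟩
  | .add d a b, s => ⟨s.pc + 1, Function.update s.regs d (s.regs a + s.regs b), s.mem⟩
  | .sub d a b, s => ⟨s.pc + 1, Function.update s.regs d (s.regs a - s.regs b), s.mem⟩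
  | .load d a, s => ⟨s.pc + 1, Function.update s.regs d (s.mem (s.regs a)), s.mem⟩
  | .store a b, s => ⟨s.pc + 1, s.regs, Function.update s.mem (s.regs a) (s.regs b)⟩
  | .jle a b target, s => ⟨if s.regs a ≤ s.regs b then target else s.pc + 1, s.regs, s.mem⟩

/-- One machine step; a program has halted when its program counter is out of range. -/
def step (P : Program) (s : Config) : Config :=
  match P[s.pc]? with
  | none => s
  | some ins => ins.exec s

/-- Started on registers `r` and memory `m`, the program `P` halts within `C` steps, with registers
`r'` and with the memory unchanged. -/
def RunsWithin (P : Program) (C : ℕ) (m r r' : ℕ → ℕ) : Prop :=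
  let s := (step P)^[C] ⟨0, r, m⟩
  P.length ≤ s.pc ∧ s.regs = r' ∧ s.mem = m

/-- `P` is run once for each address in the list, in that order and with the address in register
`0`, every run taking at most `C` steps; the other registers persist between the runs. -/
def SweepsWithin (P : Program) (C : ℕ) (m : ℕ → ℕ) : List ℕ → (ℕ → ℕ) → (ℕ → ℕ) → Prop
  | [], r, r' => r = r'
  | h :: hs, r, r' =>
      ∃ r₁, RunsWithin P C m (Function.update r 0 h) r₁ ∧ SweepsWithin P C m hs r₁ r'

/-! ### Layout of the multilayer suffix tree in memory -/

section Layout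

variable {A : Type*}

/-- The null-terminated sibling list starting at `p` consists of the given nodes. -/
def SiblingChain (m : ℕ → ℕ) (addr : List A → ℕ) : ℕ → List (List A) → Prop
  | p, [] => p = 0
  | p, v :: vs => p = addr v ∧ SiblingChain m addr (m (p + 5)) vs

/-- The memory `m` holds, at address `h`, the layer of size `α` at time `i`.

A node record at address `p` has the cells
`p` (text position of the label of the incoming edge), `p+1` (string depth, kept for internal nodes;
leaf edges are open-ended), `p+2` (parent), `p+3` (suffix link), `p+4` (first child),
`p+5` (next sibling).  The label of an edge refers to a suffix that has been explicitly added to the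
tree, i.e. one starting in the window and before `i`.

The layer record at address `h` has the cells `h` (window start), `h+1` (number of symbols consumed),
`h+2` (root), and, as the reference to the tracked repeated suffix, `h+3` (the deepest explicit node
on its path), `h+4` (the lower end of the edge inside which it ends, `0` if it ends at a node)
and `h+5` (the number of symbols below the node `h+3`). -/
def StoresLayer (T : List A) (α i : ℕ) (m : ℕ → ℕ) (h : ℕ) : Prop :=
  let lo := windowStart α i
  let W := layerText T α i
  let q := pointed T α i
  ∃ addr : List A → ℕ,
    Set.InjOn addr {w | IsNode W w} ∧
    (∀ w, IsNode W w → addr w ≠ 0) ∧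
    m (addr [] + 1) = 0 ∧
    (∀ w, IsBranching W w → m (addr w + 1) = w.length) ∧
    (∀ u v, IsChild W u v → m (addr v + 2) = addr u ∧
      ∃ y, lo ≤ y ∧ y < i ∧ y + v.length ≤ layerEnd T α i ∧ factor T y (y + v.length) = v ∧
        m (addr v) = y + u.length) ∧
    (∀ c u, IsBranching W (c :: u) → m (addr (c :: u) + 3) = addr u) ∧
    (∀ u, IsNode W u → ∃ vs : List (List A), vs.Nodup ∧ (∀ v, v ∈ vs ↔ IsChild W u v) ∧
      SiblingChain m addr (m (addr u + 4)) vs) ∧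
    m h = lo ∧
    m (h + 1) = layerEnd T α i ∧
    m (h + 2) = addr [] ∧
    ∃ u, IsNode W u ∧ u <+: q ∧ (∀ x, IsNode W x → x <+: q → x <+: u) ∧
      m (h + 3) = addr u ∧
      m (h + 5) = q.length - u.length ∧
      ((u = q ∧ m (h + 4) = 0) ∨
        (u ≠ q ∧ ∃ v, IsChild W u v ∧ q <+: v ∧ m (h + 4) = addr v))

/-- The memory `m` holds, at address `b`, the multilayer suffix tree of `T` at time `i`: the cells
`b` (time), `b+1` (address of the text), `b+2` (number of layers) and `b+3+t` (address of the
`t`-th smallest layer).  The text is known up to position `i + LPF[i]`. -/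
def StoresMLST (code : A ↪ ℕ) (bitlen : ℕ → ℕ) (T : List A) (i : ℕ) (m : ℕ → ℕ) (b : ℕ) : Prop :=
  m b = i ∧
  (∀ (k : ℕ) (hk : k < T.length), k < i + lpf T i → m (m (b + 1) + k) = code T[k]) ∧
  m (b + 2) = (layerList bitlen T.length).length ∧
  ∀ (t : ℕ) (ht : t < (layerList bitlen T.length).length),
    StoresLayer T (layerList bitlen T.length)[t] i m (m (b + 3 + t))

/-- Addresses of the layers of a multilayer suffix tree stored at `b`, from the largest layer to the
smallest one. -/
def layersDown (m : ℕ → ℕ) (b : ℕ) : List ℕ :=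
  ((List.range (m (b + 2))).map (fun t => m (b + 3 + t))).reverse

end Layout

end MLST

open MLST

/-! A layer stops growing exactly at its windowed longest previous factor (`layerEnd_eq`). A copy of
`T[i..k+1)` lying inside `T[lo..k)` must start before `i`, so the tree test already covers copies
that run over `i`. The lengths passing the test are closed downwards, so greedy growth reaches their
maximum. When `i` advances, shifting the copy by one keeps the tracked suffix repeated.

Let `r` be the smallest offset of the longest previous factor `w`. Some layer `β ≥ r` has the same
codeword length as `r`, and its window contains the rightmost occurrence, so it points to all of
`w`. The smallest layer `α` pointing to `w` thus has `α ≤ β`. Any occurrence in the window of `α`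
has offset between `r` and `α`, and monotonicity of `bitlen` forces equal cost
(`isREP_of_smallest`).

An occurrence is read off in constant time, because an edge label position minus the depth of the
upper node is the start of an occurrence of the lower node (`StoresLayer.record`). The sweep keeps
the last layer attaining the maximal length, hence the smallest one (`sweep_runs`). That such a
memory exists rests on `exists_early_occ`: every nonempty factor of the window content has a copy
starting before `i`. -/

namespace MLST

/-! ### Factors and the end point of a layer -/

section Text

variable {A : Type*}

theorem getElem?_factor (T : List A) (a b d : ℕ) :
    (factor T a b)[d]? = if d < b - a then T[a + d]? else none := by
  simp [factor, List.getElem?_take]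

theorem length_factor (T : List A) {a b : ℕ} (hb : b ≤ T.length) :
    (factor T a b).length = b - a := by
  simp [factor]; omega

theorem factor_eq_iff (T : List A) (y i l : ℕ) :
    factor T y (y + l) = factor T i (i + l) ↔ ∀ d < l, T[y + d]? = T[i + d]? := by
  constructor
  · intro h d hd
    have := congrArg (fun w => w[d]?) h
    simpa [getElem?_factor, hd] using this
  · intro h
    refine List.ext_getElem? fun d => ?_
    rw [getElem?_factor, getElem?_factor]
    by_cases hd : d < l
    · simpa [hd] using h d hd
    · simp [hd]

theorem factor_eq_word_iff (T : List A) (y : ℕ) (w : List A) :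
    factor T y (y + w.length) = w ↔ ∀ d < w.length, T[y + d]? = w[d]? := by
  constructor
  · intro h d hd
    have := congrArg (fun w => w[d]?) h
    simpa [getElem?_factor, hd] using this
  · intro h
    refine List.ext_getElem? fun d => ?_
    rw [getElem?_factor]
    by_cases hd : d < w.length
    · simpa [hd] using h d hd
    · simp [hd]

theorem prefix_drop_iff (T : List A) (y : ℕ) (w : List A) :
    w <+: T.drop y ↔ factor T y (y + w.length) = w := by
  rw [List.prefix_iff_eq_take, factor, Nat.add_sub_cancel_left, eq_comm]

theorem infix_factor_iff (T : List A) {lo k : ℕ} (hk : k ≤ T.length) (hlo : lo ≤ k) (w : List A) :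
    w <:+: factor T lo k ↔
      ∃ y, lo ≤ y ∧ y + w.length ≤ k ∧ factor T y (y + w.length) = w := by
  constructor
  · rintro ⟨s, t, h⟩
    have hl := congrArg List.length h
    rw [length_factor T hk] at hl
    simp only [List.length_append] at hl
    refine ⟨lo + s.length, by omega, by omega, ?_⟩
    rw [factor_eq_word_iff]
    intro d hd
    have h2 := congrArg (fun w => w[s.length + d]?) h
    simp only [getElem?_factor] at h2
    rw [if_pos (by omega), List.append_assoc, List.getElem?_append_right (by omega),
      List.getElem?_append_left (by omega)] at h2
    rw [Nat.add_assoc, ← h2]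
    congr 1
    omega
  · rintro ⟨y, h1, h2, h3⟩
    have hpre : w <+: (factor T lo k).drop (y - lo) := by
      rw [← h3]
      simp only [factor, List.drop_take, List.drop_drop]
      rw [show lo + (y - lo) = y by omega]
      exact List.take_prefix_take_left (by omega)
    exact hpre.isInfix.trans (List.drop_suffix _ _).isInfix

/-- Lengths of the factors starting at `i` that occur at a position in `[lo, i)`. -/
def repeatLengths (T : List A) (lo i : ℕ) : Set ℕ :=
  {l | i + l ≤ T.length ∧ ∃ y, lo ≤ y ∧ y < i ∧ factor T y (y + l) = factor T i (i + l)}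

theorem repeatLengths_bddAbove (T : List A) (lo i : ℕ) : BddAbove (repeatLengths T lo i) :=
  ⟨T.length, fun _ h => by have := h.1; omega⟩

theorem le_lpfFrom {T : List A} {lo i l : ℕ} (h : l ∈ repeatLengths T lo i) :
    l ≤ lpfFrom T lo i :=
  le_csSup (repeatLengths_bddAbove T lo i) h

theorem repeatLengths_anti {T : List A} {lo i l l' : ℕ} (h : l ∈ repeatLengths T lo i)
    (hl : l' ≤ l) : l' ∈ repeatLengths T lo i := by
  obtain ⟨h1, y, h2, h3, h4⟩ := h
  refine ⟨by omega, y, h2, h3, ?_⟩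
  rw [factor_eq_iff] at h4 ⊢
  exact fun d hd => h4 d (by omega)

theorem zero_mem_repeatLengths {T : List A} {lo i : ℕ} (hlo : lo < i) (hi : i ≤ T.length) :
    0 ∈ repeatLengths T lo i :=
  ⟨hi, lo, le_rfl, hlo, by simp [factor]⟩

theorem lpfFrom_mem {T : List A} {lo i : ℕ} (hlo : lo < i) (hi : i ≤ T.length) :
    lpfFrom T lo i ∈ repeatLengths T lo i :=
  Nat.sSup_mem ⟨0, zero_mem_repeatLengths hlo hi⟩ (repeatLengths_bddAbove T lo i)

theorem lpfFrom_zero (T : List A) (lo : ℕ) : lpfFrom T lo 0 = 0 := by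
  simp [lpfFrom]

theorem add_lpfFrom_le {T : List A} (lo : ℕ) {i : ℕ} (hi : i ≤ T.length) :
    i + lpfFrom T lo i ≤ T.length := by
  by_cases h : lo < i
  · exact (lpfFrom_mem h hi).1
  · have h0 : lpfFrom T lo i = 0 := by
      have : repeatLengths T lo i = ∅ := by
        ext l
        simp only [repeatLengths, Set.mem_ofPred_eq, Set.mem_empty_iff_false, iff_false]
        rintro ⟨-, y, h1, h2, -⟩
        omega
      change sSup (repeatLengths T lo i) = 0
      simp [this]
    omega

theorem lpfFrom_anti {T : List A} {lo lo' i : ℕ} (h : lo ≤ lo') (hlo : lo' < i)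
    (hi : i ≤ T.length) : lpfFrom T lo' i ≤ lpfFrom T lo i := by
  obtain ⟨h1, y, h2, h3⟩ := lpfFrom_mem hlo hi
  exact le_lpfFrom ⟨h1, y, h.trans h2, h3⟩

/-- A word of length `k + 1 - i` that ends by position `k` starts before `i`; conversely a copy
starting before `i` ends by `k`. -/
theorem infix_succ_iff {T : List A} {lo i k : ℕ} (hlo : lo < i) (hik : i ≤ k) (hk : k < T.length) :
    factor T i (k + 1) <:+: factor T lo k ↔ k + 1 - i ∈ repeatLengths T lo i := by
  rw [infix_factor_iff T hk.le (by omega), length_factor T (by omega)]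
  have e : i + (k + 1 - i) = k + 1 := by omega
  simp only [repeatLengths, Set.mem_ofPred_eq, e]
  constructor
  · rintro ⟨y, h1, h2, h3⟩
    exact ⟨by omega, y, h1, by omega, h3⟩
  · rintro ⟨-, y, h1, h2, h3⟩
    exact ⟨y, h1, by omega, h3⟩

/-- The membership `hmem` is the loop invariant. By downward closure of `repeatLengths`, the first
failing length is one more than the maximum. -/
theorem grow_eq {T : List A} {lo i k : ℕ} (hlo : lo < i) (hik : i ≤ k) (hk : k ≤ T.length)
    (hmem : k - i ∈ repeatLengths T lo i) : grow T lo i k = i + lpfFrom T lo i := by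
  obtain ⟨n, hn⟩ : ∃ n, T.length - k = n := ⟨_, rfl⟩
  induction n generalizing k with
  | zero =>
    rw [grow, dif_neg (by omega)]
    have h1 := le_lpfFrom hmem
    have h2 := add_lpfFrom_le lo (hik.trans hk)
    omega
  | succ n ih =>
    rw [grow]
    split_ifs with h
    · rw [infix_succ_iff hlo hik h.1] at h
      exact ih (by omega) (by omega) h.2 (by omega)
    · have hk' : k < T.length := by omega
      rw [infix_succ_iff hlo hik hk'] at h
      have h1 := le_lpfFrom hmem
      by_contra hne
      exact h ⟨hk', repeatLengths_anti (lpfFrom_mem hlo (hik.trans hk)) (by omega)⟩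

theorem windowStart_lt {α i : ℕ} (hi : 0 < i) : windowStart α i < i := by
  unfold windowStart; omega

theorem layerEnd_eq (T : List A) (α : ℕ) {i : ℕ} (hi : i ≤ T.length) :
    layerEnd T α i = i + lpfFrom T (windowStart α i) i := by
  induction i with
  | zero =>
    rw [layerEnd, lpfFrom_zero, grow, dif_neg]
    -- At time 0 the text read is empty and cannot contain a one-symbol word.
    rintro ⟨h, h2⟩
    have := h2.length_le
    rw [length_factor T (by omega)] at this
    simp [factor] at this
  | succ i ih =>
    have ih := ih (by omega)
    have hle := add_lpfFrom_le (windowStart α i) (show i ≤ T.length by omega)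
    rw [layerEnd]
    apply grow_eq (windowStart_lt (by omega)) (le_max_right _ _) (by omega)
    by_cases h0 : lpfFrom T (windowStart α i) i = 0
    -- The layer had stopped at `i` itself, so the new tracked suffix starts out empty.
    · rw [show max (layerEnd T α i) (i + 1) - (i + 1) = 0 by omega]
      exact zero_mem_repeatLengths (windowStart_lt (by omega)) hi
    · have hpos : 0 < i := by
        rcases Nat.eq_zero_or_pos i with rfl | h
        · exact absurd (lpfFrom_zero _ _) h0
        · exact h
      obtain ⟨h1, y, h2, h3, h4⟩ := lpfFrom_mem (T := T) (windowStart_lt (α := α) hpos) (by omega)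
      rw [factor_eq_iff] at h4
      -- The window start advances by at most one, so the shifted copy `y + 1` stays inside.
      refine ⟨by omega, y + 1, by unfold windowStart at h2 ⊢; omega, by omega, ?_⟩
      rw [factor_eq_iff]
      intro d hd
      have := h4 (d + 1) (by omega)
      rwa [show y + (d + 1) = y + 1 + d by omega, show i + (d + 1) = i + 1 + d by omega] at this

theorem layerEnd_le (T : List A) (α : ℕ) {i : ℕ} (hi : i ≤ T.length) :
    layerEnd T α i ≤ T.length :=
  layerEnd_eq T α hi ▸ add_lpfFrom_le _ hi

theorem length_pointed (T : List A) (α : ℕ) {i : ℕ} (hi : i ≤ T.length) :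
    (pointed T α i).length = lpfFrom T (windowStart α i) i := by
  rw [pointed, length_factor T (layerEnd_le T α hi), layerEnd_eq T α hi]
  omega

theorem length_lpfWord (T : List A) {i : ℕ} (hi : i ≤ T.length) :
    (lpfWord T i).length = lpf T i := by
  have : i + lpf T i ≤ T.length := add_lpfFrom_le 0 hi
  rw [lpfWord, length_factor T this]
  omega

theorem length_pointed_le (T : List A) (α : ℕ) {i : ℕ} (hi : i ≤ T.length) :
    (pointed T α i).length ≤ lpf T i := by
  rw [length_pointed T α hi]
  rcases Nat.eq_zero_or_pos i with rfl | h
  · simp [lpfFrom_zero]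
  · exact lpfFrom_anti (Nat.zero_le _) (windowStart_lt h) hi

theorem windowStart_length (T : List A) {i : ℕ} (hi : i ≤ T.length) :
    windowStart T.length i = 0 := by
  unfold windowStart; omega

theorem length_pointed_length (T : List A) {i : ℕ} (hi : i ≤ T.length) :
    (pointed T T.length i).length = lpf T i := by
  rw [length_pointed T _ hi, windowStart_length T hi, lpf]

end Text

/-! ### Layer sizes and equal cost -/

section Sizes

theorem length_mem_layerSizes {bitlen : ℕ → ℕ} (n : ℕ) :
    n ∈ layerSizes bitlen n := by
  refine Finset.mem_image.mpr ⟨bitlen n, Finset.mem_image_of_mem _ (by simp), ?_⟩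
  exact le_antisymm (Nat.findGreatest_le _) (Nat.le_findGreatest le_rfl le_rfl)

theorem le_of_mem_layerSizes {bitlen : ℕ → ℕ} {n α : ℕ} (h : α ∈ layerSizes bitlen n) :
    α ≤ n := by
  obtain ⟨b, -, rfl⟩ := Finset.mem_image.mp h
  exact Nat.findGreatest_le _

/-- The layer is the one contributed to `SW` by the codeword length of `r`. -/
theorem exists_layer_ge {bitlen : ℕ → ℕ} {n r : ℕ} (hr : r ≤ n) :
    ∃ β ∈ layerSizes bitlen n, r ≤ β ∧ bitlen β ≤ bitlen r := by
  refine ⟨_, Finset.mem_image.mpr ⟨bitlen r,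
    Finset.mem_image_of_mem _ (by simp; omega), rfl⟩, ?_, ?_⟩
  · exact Nat.le_findGreatest hr le_rfl
  · exact Nat.findGreatest_spec (P := fun j => bitlen j ≤ bitlen r) hr le_rfl

end Sizes

/-- The position `j` serves the layer `α`: it is an occurrence of the pointed factor inside the
window, and the last position before `i` if that factor is empty. -/
def Serves {A : Type*} (T : List A) (i α j : ℕ) : Prop :=
  (0 < i → windowStart α i ≤ j ∧ j < i ∧
    factor T j (j + (pointed T α i).length) = pointed T α i) ∧
  ((pointed T α i).length = 0 → j = i - 1)

theorem pointed_eq_lpfWord {A : Type*} {T : List A} {i α : ℕ} (hi : i ≤ T.length)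
    (h : (pointed T α i).length = lpf T i) : pointed T α i = lpfWord T i := by
  rw [length_pointed T α hi] at h
  rw [pointed, lpfWord, layerEnd_eq T α hi, h]

theorem Serves.mem_prevPos {A : Type*} {T : List A} {i α j : ℕ} (hi : i ≤ T.length)
    (h : (pointed T α i).length = lpf T i) (hj : Serves T i α j) (hpos : 0 < i) :
    j ∈ prevPos T i (lpfWord T i) := by
  obtain ⟨-, h2, h3⟩ := hj.1 hpos
  rw [pointed_eq_lpfWord hi h] at h3
  exact ⟨h2, (prefix_drop_iff _ _ _).mpr h3⟩

/-- An occurrence found in the smallest layer that points to the longest previous factor is a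
rightmost equal-cost position. -/
theorem isREP_of_smallest {A : Type*} {bitlen : ℕ → ℕ} (hb : Monotone bitlen) {T : List A}
    {i α j : ℕ} (hi : i ≤ T.length)
    (h : (pointed T α i).length = lpf T i) (hj : Serves T i α j)
    (hmin : ∀ β ∈ layerSizes bitlen T.length, β < α → (pointed T β i).length < lpf T i) :
    IsREP bitlen T i (lpfWord T i) j := by
  rcases Nat.eq_zero_or_pos i with rfl | hpos
  · refine ⟨?_, fun _ => ?_⟩
    · rintro ⟨x, y, hy, -⟩
      exact absurd hy.1 (by omega)
    -- At `i = 0` the truncated value `i - 1` is the default answer `0`.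
    · exact hj.2 (by rw [length_pointed T α hi, lpfFrom_zero])
  · have hmem := hj.mem_prevPos hi h hpos
    have hjo : i - j - 1 ∈ prevOffset T i (lpfWord T i) := ⟨j, hmem, rfl⟩
    refine ⟨fun hne => ⟨hmem, ?_⟩, fun he => absurd hjo (by simp [he])⟩
    refine ⟨sInf (prevOffset T i (lpfWord T i)), ⟨Nat.sInf_mem hne, fun x hx => Nat.sInf_le hx⟩, ?_⟩
    obtain ⟨y, hy, hr⟩ := Nat.sInf_mem hne
    have hrj := Nat.sInf_le hjo
    set r := sInf (prevOffset T i (lpfWord T i))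
    obtain ⟨β, hβ, hrβ, hβr⟩ := exists_layer_ge (bitlen := bitlen) (show r ≤ T.length by omega)
    -- Since `r ≤ β`, the rightmost occurrence `y` lies in the window of `β`.
    have hβlen : lpf T i ≤ (pointed T β i).length := by
      rw [length_pointed T β hi]
      refine le_lpfFrom ⟨add_lpfFrom_le 0 hi, y, ?_, hy.1, ?_⟩
      · have := hy.1
        unfold windowStart; omega
      · have := (prefix_drop_iff _ _ _).mp hy.2
        rwa [length_lpfWord T hi] at this
    have hαβ : α ≤ β := by
      by_contra hlt
      have := hmin β hβ (by omega)
      omega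
    have hwin := (hj.1 hpos).1
    apply le_antisymm
    -- Lying in the window of `α` means having offset at most `α`, which is at most `β`.
    · refine (hb (show i - j - 1 ≤ β by unfold windowStart at hwin; omega)).trans hβr
    · exact hb hrj

/-! ### The three programs and their execution -/

/-- Forget the best layer seen so far. -/
def resetProgram : Program := [.const 1 0, .const 2 0]

/-- Return the recorded position. -/
def queryProgram : Program := [.const 3 0, .add 0 2 3]

/-- Visit the layer whose record is at the address in register `0`. Register `1` holds the length of
the longest factor pointed to so far and register `2` a position at which it occurs. -/
def visitProgram : Program :=
  [.const 3 1, .add 4 0 3, .load 5 4, .add 4 4 3, .add 4 4 3, .load 6 4, .add 4 4 3, .load 7 4,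
   .add 4 4 3, .load 8 4, .add 4 6 3, .load 9 4, .add 10 9 8, .jle 1 10 15, .jle 1 1 30,
   .const 11 0, .add 1 10 11, .jle 10 11 29, .jle 7 11 22,
   .load 12 7, .sub 2 12 9, .jle 0 0 30,
   .load 12 6, .add 4 4 3, .load 13 4, .add 13 13 3, .load 13 13, .sub 2 12 13, .jle 0 0 30,
   .sub 2 5 3]

/-- Length of the factor pointed to by the layer stored at `h`. -/
def recordLength (m : ℕ → ℕ) (h : ℕ) : ℕ := m (m (h + 3) + 1) + m (h + 5)

/-- Position read off the layer stored at `h`. -/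
def recordPos (m : ℕ → ℕ) (h : ℕ) : ℕ :=
  if recordLength m h = 0 then m (h + 1) - 1
  else if m (h + 4) = 0 then m (m (h + 3)) - m (m (m (h + 3) + 2) + 1)
  else m (m (h + 4)) - m (m (h + 3) + 1)

/-- Started at `pc` with registers `r`, the program halts within `n` steps, without changing the
memory and with final registers satisfying `Q`. -/
def Post (P : Program) (m : ℕ → ℕ) (n pc : ℕ) (r : ℕ → ℕ) (Q : (ℕ → ℕ) → Prop) : Prop :=
  ∃ r', (step P)^[n] ⟨pc, r, m⟩ = ⟨P.length, r', m⟩ ∧ Q r'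

section Post

variable {P : Program} {m : ℕ → ℕ} {n pc : ℕ} {r : ℕ → ℕ} {Q : (ℕ → ℕ) → Prop}

theorem Post.runs (h : Post P m n 0 r Q) : ∃ r', RunsWithin P n m r r' ∧ Q r' := by
  obtain ⟨r', h1, h2⟩ := h
  exact ⟨r', by simp [RunsWithin, h1], h2⟩

/-- A halted configuration is a fixed point of `step`, so an unused step budget is harmless. -/
theorem Post.halt (hpc : pc = P.length) (h : Q r) : Post P m n pc r Q := by
  refine ⟨r, ?_, h⟩
  subst hpc
  exact Function.iterate_fixed (by simp [step]) n

theorem Post.of_exec {ins : Instr} (hi : P[pc]? = some ins) {pc' : ℕ} {r' : ℕ → ℕ}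
    (he : ins.exec ⟨pc, r, m⟩ = ⟨pc', r', m⟩) (h : Post P m n pc' r' Q) :
    Post P m (n + 1) pc r Q := by
  obtain ⟨r₁, h1, h2⟩ := h
  refine ⟨r₁, ?_, h2⟩
  rw [Function.iterate_succ_apply, ← h1, ← he]
  simp [step, hi]

theorem Post.const {d c : ℕ} (hi : P[pc]? = some (.const d c))
    (h : Post P m n (pc + 1) (Function.update r d c) Q) : Post P m (n + 1) pc r Q :=
  .of_exec hi rfl h

/-- The result `v` is supplied explicitly so that register contents stay in simplified form along a
run. -/
theorem Post.add (v : ℕ) {d a b : ℕ} (hi : P[pc]? = some (.add d a b)) (hv : r a + r b = v)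
    (h : Post P m n (pc + 1) (Function.update r d v) Q) : Post P m (n + 1) pc r Q :=
  .of_exec hi (by rw [Instr.exec, hv]) h

theorem Post.sub (v : ℕ) {d a b : ℕ} (hi : P[pc]? = some (.sub d a b)) (hv : r a - r b = v)
    (h : Post P m n (pc + 1) (Function.update r d v) Q) : Post P m (n + 1) pc r Q :=
  .of_exec hi (by rw [Instr.exec, hv]) h

theorem Post.load (v : ℕ) {d a : ℕ} (hi : P[pc]? = some (.load d a)) (hv : r a = v)
    (h : Post P m n (pc + 1) (Function.update r d (m v)) Q) : Post P m (n + 1) pc r Q :=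
  .of_exec hi (by subst hv; rfl) h

theorem Post.jump {a b t : ℕ} (hi : P[pc]? = some (.jle a b t)) (hv : r a ≤ r b)
    (h : Post P m n t r Q) : Post P m (n + 1) pc r Q :=
  .of_exec hi (by simp [Instr.exec, hv]) h

theorem Post.pass {a b t : ℕ} (hi : P[pc]? = some (.jle a b t)) (hv : ¬ r a ≤ r b)
    (h : Post P m n (pc + 1) r Q) : Post P m (n + 1) pc r Q :=
  .of_exec hi (by simp [Instr.exec, hv]) h

end Post

theorem reset_runs (m r : ℕ → ℕ) : ∃ r', RunsWithin resetProgram 30 m r r' ∧ r' 1 = 0 :=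
  Post.runs <| .const rfl <| .const rfl <| .halt rfl <| by simp [Function.update]

theorem query_runs (m r : ℕ → ℕ) : ∃ r', RunsWithin queryProgram 30 m r r' ∧ r' 0 = r 2 :=
  Post.runs <| .const rfl <| .add (r 2) rfl (by simp) <| .halt rfl <| by simp

/-- All jumps go forward, so 30 steps, one per instruction, suffice. The comparison is `≤`: on a tie
the layer visited later replaces the recorded one. -/
theorem visit_runs (m r : ℕ → ℕ) :
    ∃ r', RunsWithin visitProgram 30 m r r' ∧
      r' 1 = (if r 1 ≤ recordLength m (r 0) then recordLength m (r 0) else r 1) ∧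
      r' 2 = (if r 1 ≤ recordLength m (r 0) then recordPos m (r 0) else r 2) := by
  set l := recordLength m (r 0) with hl
  refine Post.runs <| .const rfl <| .add (r 0 + 1) rfl (by simp) <|
    .load (r 0 + 1) rfl (by simp) <| .add (r 0 + 2) rfl (by simp) <|
    .add (r 0 + 3) rfl (by simp) <| .load (r 0 + 3) rfl (by simp) <|
    .add (r 0 + 4) rfl (by simp) <| .load (r 0 + 4) rfl (by simp) <|
    .add (r 0 + 5) rfl (by simp) <| .load (r 0 + 5) rfl (by simp) <|
    .add (m (r 0 + 3) + 1) rfl (by simp) <| .load (m (r 0 + 3) + 1) rfl (by simp) <|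
    .add l rfl (by simp [hl, recordLength]) ?_
  by_cases h1 : r 1 ≤ l
  · refine .jump rfl (by simpa using h1) <| .const rfl <| .add l rfl (by simp) ?_
    by_cases h2 : l = 0
    · refine .jump rfl (by simp [h2]) <| .sub (m (r 0 + 1) - 1) rfl (by simp) <| .halt rfl ?_
      have h0 : r 1 = 0 := by omega
      simp [h0, recordPos, ← hl, h2]
    · refine .pass rfl (by simpa using h2) ?_
      by_cases h3 : m (r 0 + 4) = 0
      · refine .jump rfl (by simp [h3]) <| .load (m (r 0 + 3)) rfl (by simp) <|
          .add (m (r 0 + 3) + 2) rfl (by simp) <| .load (m (r 0 + 3) + 2) rfl (by simp) <|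
          .add (m (m (r 0 + 3) + 2) + 1) rfl (by simp) <|
          .load (m (m (r 0 + 3) + 2) + 1) rfl (by simp) <|
          .sub (m (m (r 0 + 3)) - m (m (m (r 0 + 3) + 2) + 1)) rfl (by simp) <|
          .jump rfl le_rfl <| .halt rfl ?_
        simp [h1, recordPos, ← hl, h2, h3]
      · refine .pass rfl (by simpa using h3) <| .load (m (r 0 + 4)) rfl (by simp) <|
          .sub (m (m (r 0 + 4)) - m (m (r 0 + 3) + 1)) rfl (by simp) <|
          .jump rfl le_rfl <| .halt rfl ?_
        simp [h1, recordPos, ← hl, h2, h3]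
  · refine .pass rfl (by simpa using h1) <| .jump rfl le_rfl <| .halt rfl ?_
    simp [h1]

/-! ### Nodes and edges of implicit suffix trees -/

section Tree

variable {A : Type*}

/-- Prefixes of `q` are nested, so the longest good one dominates. This yields parents as well as
the deepest node above a locus. -/
theorem exists_longest_prefix (P : List A → Prop) (h0 : P []) (q : List A) :
    ∃ u, u <+: q ∧ P u ∧ ∀ x, P x → x <+: q → x <+: u := by
  classical
  refine ⟨q.take (Nat.findGreatest (fun k => P (q.take k)) q.length), List.take_prefix _ _,
    Nat.findGreatest_spec (P := fun k => P (q.take k)) (Nat.zero_le _) (by simpa using h0), ?_⟩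
  intro x hx hxq
  have hxe := List.prefix_iff_eq_take.mp hxq
  rw [hxe]
  exact List.take_prefix_take_left (Nat.le_findGreatest hxq.length_le (by rwa [← hxe]))

theorem exists_append_prefix {u v : List A} (h : u <+: v) (hne : u ≠ v) :
    ∃ c, u ++ [c] <+: v := by
  obtain ⟨t, rfl⟩ := h
  cases t with
  | nil => simp at hne
  | cons c t => exact ⟨c, t, by simp⟩

theorem prefix_antisymm {u v : List A} (h : u <+: v) (h' : v <+: u) : u = v :=
  h.eq_of_length (le_antisymm h.length_le h'.length_le)

theorem IsNode.isInfix {W v : List A} (h : IsNode W v) : v <:+: W := by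
  rcases h with rfl | ⟨c, -, -, h, -⟩ | h
  · exact List.nil_infix
  · exact (List.prefix_append v [c]).isInfix.trans h
  · exact h.1

theorem isNode_nil (W : List A) : IsNode W [] := Or.inl rfl

/-- String depths are guaranteed only at the root and at branching nodes; a right extension rules
out the remaining case, a leaf. -/
theorem IsNode.internal {W u : List A} (h : IsNode W u) {c : A} (hc : u ++ [c] <:+: W) :
    u = [] ∨ IsBranching W u := by
  rcases h with h | h | h
  · exact .inl h
  · exact .inr h
  · exact absurd hc (h.2 c)

theorem IsChild.internal {W u v : List A} (h : IsChild W u v) : u = [] ∨ IsBranching W u := by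
  obtain ⟨hu, hv, huv, hne, -⟩ := h
  obtain ⟨c, hc⟩ := exists_append_prefix huv hne
  exact hu.internal (hc.isInfix.trans hv.isInfix)

theorem IsChild.ne_nil {W u v : List A} (h : IsChild W u v) : v ≠ [] := by
  rintro rfl
  exact h.2.2.2.1 (List.prefix_nil.mp h.2.2.1)

theorem IsChild.parent_unique {W u u' v : List A} (h : IsChild W u v) (h' : IsChild W u' v) :
    u = u' :=
  prefix_antisymm (h'.2.2.2.2 u h.1 h.2.2.1 h.2.2.2.1) (h.2.2.2.2 u' h'.1 h'.2.2.1 h'.2.2.2.1)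

theorem exists_parent {W v : List A} (hv : IsNode W v) (hne : v ≠ []) : ∃ u, IsChild W u v := by
  obtain ⟨u, h1, h2, h3⟩ := exists_longest_prefix (fun x => IsNode W x ∧ x ≠ v)
    ⟨isNode_nil W, hne.symm⟩ v
  exact ⟨u, h2.1, hv, h1, h2.2, fun x hx hxv hxn => h3 x ⟨hx, hxn⟩ hxv⟩

/-- Extend `q` to the right until no extension occurs in `W`; the result is a leaf. -/
theorem exists_node_below {W q : List A} (hq : q <:+: W) : ∃ v, q <+: v ∧ IsNode W v := by
  obtain ⟨n, hn⟩ : ∃ n, W.length - q.length = n := ⟨_, rfl⟩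
  induction n generalizing q with
  | zero =>
    refine ⟨q, List.prefix_rfl, .inr (.inr ⟨hq, fun c hc => ?_⟩)⟩
    have := hc.length_le
    simp at this
    omega
  | succ n ih =>
    by_cases h : ∃ c, q ++ [c] <:+: W
    · obtain ⟨c, hc⟩ := h
      obtain ⟨v, h1, h2⟩ := ih hc (by simp; omega)
      exact ⟨v, (List.prefix_append q [c]).trans h1, h2⟩
    · exact ⟨q, List.prefix_rfl, .inr (.inr ⟨hq, fun c hc => h ⟨c, hc⟩⟩)⟩

/-- Take the shortest node `v` below `q`. A node properly above `v` cannot extend `q`, so it is a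
prefix of `q` and hence of `u`. -/
theorem exists_child_below {W u q : List A} (hq : q <:+: W) (hu : IsNode W u) (huq : u <+: q)
    (hne : u ≠ q) (hmax : ∀ x, IsNode W x → x <+: q → x <+: u) :
    ∃ v, IsChild W u v ∧ q <+: v := by
  classical
  have hex : ∃ l v, q <+: v ∧ IsNode W v ∧ v.length = l := by
    obtain ⟨v, h1, h2⟩ := exists_node_below hq
    exact ⟨_, v, h1, h2, rfl⟩
  obtain ⟨v, hqv, hv, hl⟩ := Nat.find_spec hex
  refine ⟨v, ⟨hu, hv, huq.trans hqv, ?_, ?_⟩, hqv⟩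
  · rintro rfl
    exact hne (prefix_antisymm huq hqv)
  · intro x hx hxv hxne
    rcases List.prefix_or_prefix_of_prefix hxv hqv with h | h
    · exact hmax x hx h
    · exfalso
      refine hxne (hxv.eq_of_length (le_antisymm hxv.length_le ?_))
      rw [hl]
      exact Nat.find_min' hex ⟨x, h, hx, rfl⟩

end Tree

/-! ### Occurrences in the window, and reading a layer record -/

section Window

variable {A : Type*} {T : List A} {α i : ℕ}

theorem windowStart_le (α i : ℕ) : windowStart α i ≤ i := by
  unfold windowStart; omega

theorem le_layerEnd (hi : i ≤ T.length) : i ≤ layerEnd T α i := by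
  rw [layerEnd_eq T α hi]; omega

theorem exists_pointed_occ (hi : i ≤ T.length) (hlt : 0 < i) :
    ∃ y, windowStart α i ≤ y ∧ y < i ∧
      factor T y (y + (pointed T α i).length) = pointed T α i := by
  obtain ⟨-, y, h1, h2, h3⟩ := lpfFrom_mem (windowStart_lt (α := α) hlt) hi
  refine ⟨y, h1, h2, ?_⟩
  rw [length_pointed T α hi, h3, pointed, layerEnd_eq T α hi]

theorem pos_of_lt_layerEnd (hi : i ≤ T.length) (h : i < layerEnd T α i) : 0 < i := by
  rcases Nat.eq_zero_or_pos i with rfl | h'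
  · rw [layerEnd_eq T α hi, lpfFrom_zero] at h
    omega
  · exact h'

theorem length_pointed_add (hi : i ≤ T.length) :
    i + (pointed T α i).length = layerEnd T α i := by
  rw [length_pointed T α hi, layerEnd_eq T α hi]

/-- Every nonempty factor of the window content occurs at a position of the window before `i`. -/
theorem exists_early_occ (hi : i ≤ T.length) {v : List A} (hv : v <:+: layerText T α i)
    (hne : v ≠ []) :
    ∃ y, windowStart α i ≤ y ∧ y < i ∧ y + v.length ≤ layerEnd T α i ∧
      factor T y (y + v.length) = v := by
  rw [layerText, infix_factor_iff T (layerEnd_le T α hi)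
    ((windowStart_le α i).trans (le_layerEnd hi))] at hv
  obtain ⟨y, h1, h2, h3⟩ := hv
  have hpos := List.length_pos_iff.mpr hne
  induction y using Nat.strong_induction_on with
  | _ y ih =>
    by_cases hy : y < i
    · exact ⟨y, h1, hy, h2, h3⟩
    · obtain ⟨z, hz1, hz2, hz3⟩ := exists_pointed_occ (α := α) hi
        (pos_of_lt_layerEnd hi (by omega : i < layerEnd T α i))
      have hlen := length_pointed_add (α := α) hi
      -- An occurrence at `y ≥ i` lies inside the pointed factor. Carried over to the copy of that
      -- factor at `z < i`, it moves left.
      refine ih (z + (y - i)) (by omega) (by omega) (by omega) ?_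
      rw [factor_eq_word_iff] at h3 hz3 ⊢
      intro d hd
      rw [← h3 d hd, Nat.add_assoc, hz3 _ (by omega), pointed, getElem?_factor,
        if_pos (by omega)]
      congr 1
      omega

theorem pointed_isInfix (hi : i ≤ T.length) : pointed T α i <:+: layerText T α i := by
  have hlen := length_pointed_add (α := α) hi
  rw [layerText, infix_factor_iff T (layerEnd_le T α hi)
    ((windowStart_le α i).trans (le_layerEnd hi))]
  exact ⟨i, windowStart_le α i, hlen.le, by rw [hlen]; rfl⟩

/-- The copy starting before `i` ends before `layerEnd`, so the symbol after it is still in the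
window. Hence a nonempty pointed factor is never a leaf. -/
theorem pointed_extends (hi : i ≤ T.length) (hne : pointed T α i ≠ []) :
    ∃ c, pointed T α i ++ [c] <:+: layerText T α i := by
  have hlen := length_pointed_add (α := α) hi
  have hpos := List.length_pos_iff.mpr hne
  have hle := layerEnd_le T α hi
  obtain ⟨y, h1, h2, h3⟩ := exists_pointed_occ (α := α) hi
    (pos_of_lt_layerEnd hi (by omega : i < layerEnd T α i))
  have hb : y + (pointed T α i).length < T.length := by omega
  refine ⟨T[y + (pointed T α i).length], ?_⟩
  rw [layerText, infix_factor_iff T hle ((windowStart_le α i).trans (le_layerEnd hi))]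
  refine ⟨y, h1, by simp; omega, ?_⟩
  rw [factor_eq_word_iff] at h3 ⊢
  intro d hd
  rw [List.length_append, List.length_singleton] at hd
  by_cases hd' : d < (pointed T α i).length
  · rw [h3 d hd', List.getElem?_append_left hd']
  · obtain rfl : d = (pointed T α i).length := by omega
    simp [hb]

/-- Length and position read off a layer record. -/
theorem StoresLayer.record {m : ℕ → ℕ} {h : ℕ} (hi : i ≤ T.length) (hs : StoresLayer T α i m h) :
    recordLength m h = (pointed T α i).length ∧ Serves T i α (recordPos m h) := by
  obtain ⟨addr, -, hnz, hroot, hdepth, hchild, -, -, -, hend, -, u, hu, huq, hmax, hm3, hm5, hq⟩ :=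
    hs
  have hlen := length_pointed_add (α := α) hi
  have hinternal : ∀ w, w = [] ∨ IsBranching (layerText T α i) w → m (addr w + 1) = w.length := by
    rintro w (rfl | hw)
    · simpa using hroot
    · exact hdepth w hw
  have hud : m (addr u + 1) = u.length := by
    apply hinternal
    by_cases hu0 : pointed T α i = []
    · left
      rw [hu0] at huq
      exact List.prefix_nil.mp huq
    · by_cases huq' : u = pointed T α i
      · obtain ⟨c, hc⟩ := pointed_extends hi hu0
        exact hu.internal (huq' ▸ hc)
      · obtain ⟨c, hc⟩ := exists_append_prefix huq huq'
        exact hu.internal (hc.isInfix.trans (pointed_isInfix hi))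
  have hrec : recordLength m h = (pointed T α i).length := by
    have := huq.length_le
    rw [recordLength, hm3, hud, hm5]
    exact Nat.add_sub_of_le this
  refine ⟨hrec, ?_⟩
  by_cases h0 : (pointed T α i).length = 0
  · have hpos : recordPos m h = i - 1 := by
      rw [recordPos, if_pos (hrec.trans h0), hend]
      omega
    refine ⟨fun hi0 => ?_, fun _ => hpos⟩
    rw [hpos, h0, List.eq_nil_of_length_eq_zero h0]
    exact ⟨by unfold windowStart; omega, by omega, by simp [factor]⟩
  · refine ⟨fun _ => ?_, fun h => absurd h h0⟩
    rw [recordPos, if_neg (by omega)]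
    rcases hq with ⟨rfl, hm4⟩ | ⟨hne, v, hv, hqv, hm4⟩
    -- The locus is a node: its incoming label starts at `y + p.length` for an occurrence `y` of the
    -- pointed factor.
    · obtain ⟨p, hp⟩ := exists_parent hu (fun h => h0 (by simp [h]))
      obtain ⟨hpar, y, h1, h2, -, h3, h4⟩ := hchild _ _ hp
      rw [if_pos hm4, hm3, hpar, h4, hinternal p hp.internal, Nat.add_sub_cancel]
      exact ⟨h1, h2, h3⟩
    -- The locus is inside an edge: an occurrence of its lower end `v` is one of the prefix `q` of
    -- `v`.
    · obtain ⟨-, y, h1, h2, -, h3, h4⟩ := hchild _ _ hv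
      rw [if_neg (hm4 ▸ hnz v hv.2.1), hm4, h4, hm3, hud, Nat.add_sub_cancel]
      refine ⟨h1, h2, ?_⟩
      rw [factor_eq_word_iff] at h3 ⊢
      intro d hd
      rw [h3 d (by have := hqv.length_le; omega)]
      exact (List.prefix_iff_getElem?.mp hqv d hd).trans (by simp [hd])

end Window

/-! ### The sweep over the layers -/

section Sweep

variable {A : Type*} {T : List A} {i : ℕ} {m : ℕ → ℕ}

/-- Invariant: `α₀` is the last visited layer of length `L`, and register 2 serves it. Sizes
decrease, so the last such layer is the smallest; layers skipped since then point to shorter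
factors. -/
theorem sweep_runs (hi : i ≤ T.length) {L : ℕ} {αs hs : List ℕ}
    (hst : List.Forall₂ (fun α h => StoresLayer T α i m h) αs hs)
    (hle : ∀ α ∈ αs, (pointed T α i).length ≤ L) (α₀ : ℕ) (hsort : (α₀ :: αs).Pairwise (· > ·))
    (h0 : (pointed T α₀ i).length = L) (r : ℕ → ℕ) (hr1 : r 1 = L) (hr2 : Serves T i α₀ (r 2)) :
    ∃ r', SweepsWithin visitProgram 30 m hs r r' ∧ ∃ α ∈ α₀ :: αs,
      (pointed T α i).length = L ∧ Serves T i α (r' 2) ∧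
      ∀ β ∈ α₀ :: αs, β < α → (pointed T β i).length < L := by
  induction hst generalizing α₀ r with
  | nil =>
    exact ⟨r, rfl, α₀, by simp, h0, hr2, fun β hβ hlt => by simp at hβ; omega⟩
  | @cons α h αs hs hα _ ih =>
    obtain ⟨r₁, hrun, hr₁, hr₂⟩ := visit_runs m (Function.update r 0 h)
    obtain ⟨hl, hserve⟩ := hα.record hi
    simp only [Function.update_self, ne_eq, one_ne_zero, not_false_eq_true,
      Function.update_of_ne, OfNat.ofNat_ne_zero, hl, hr1] at hr₁ hr₂
    have hαL := hle α (by simp)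
    have hle' : ∀ β ∈ αs, (pointed T β i).length ≤ L := fun β hβ => hle β (by simp [hβ])
    rw [List.pairwise_cons, List.pairwise_cons] at hsort
    by_cases hc : (pointed T α i).length = L
    · rw [if_pos hc.ge] at hr₁ hr₂
      obtain ⟨r', hsw, γ, hγ, h1, h2, h3⟩ := ih hle' α (List.pairwise_cons.mpr hsort.2) hc r₁
        (by omega) (hr₂ ▸ hserve)
      refine ⟨r', ⟨r₁, hrun, hsw⟩, γ, List.mem_cons_of_mem _ hγ, h1, h2, fun β hβ hlt => ?_⟩
      rcases List.mem_cons.mp hβ with rfl | hβ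
      · have := hsort.1 γ hγ
        omega
      · exact h3 β hβ hlt
    · rw [if_neg (by omega)] at hr₁ hr₂
      obtain ⟨r', hsw, γ, hγ, h1, h2, h3⟩ := ih hle' α₀
        (List.pairwise_cons.mpr ⟨fun β hβ => hsort.1 β (by simp [hβ]), hsort.2.2⟩) h0 r₁
        hr₁ (hr₂ ▸ hr2)
      refine ⟨r', ⟨r₁, hrun, hsw⟩, γ, ?_, h1, h2, fun β hβ hlt => ?_⟩
      · simp only [List.mem_cons] at hγ ⊢
        tauto
      · simp only [List.mem_cons] at hβ
        rcases hβ with rfl | rfl | hβ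
        · exact h3 _ (by simp) hlt
        · omega
        · exact h3 _ (by simp [hβ]) hlt

theorem layersDown_stores {code : A ↪ ℕ} {bitlen : ℕ → ℕ} {b : ℕ}
    (h : StoresMLST code bitlen T i m b) :
    List.Forall₂ (fun α h => StoresLayer T α i m h) (layerList bitlen T.length).reverse
      (layersDown m b) := by
  obtain ⟨-, -, hN, hst⟩ := h
  rw [layersDown, List.forall₂_reverse_iff, List.forall₂_iff_get]
  refine ⟨by simp [hN], fun t h1 h2 => ?_⟩
  simpa using hst t h1

/-- The first visit is to the layer `T.length`, whose window holds the whole past. Starting from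
length 0 it always records, which sets the target length `LPF[i]` for the rest of the sweep. -/
theorem StoresMLST.building_runs {code : A ↪ ℕ} {bitlen : ℕ → ℕ} {b : ℕ}
    (hi : i ≤ T.length) (h : StoresMLST code bitlen T i m b) (r : ℕ → ℕ)
    (hr : r 1 = 0) :
    ∃ r', SweepsWithin visitProgram 30 m (layersDown m b) r r' ∧
      ∃ α ∈ layerSizes bitlen T.length,
        (pointed T α i).length = lpf T i ∧ Serves T i α (r' 2) ∧
        ∀ β ∈ layerSizes bitlen T.length, β < α → (pointed T β i).length < lpf T i := by
  have hst := layersDown_stores h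
  have hmem : ∀ α, α ∈ (layerList bitlen T.length).reverse ↔ α ∈ layerSizes bitlen T.length := by
    simp [layerList]
  have hsort : (layerList bitlen T.length).reverse.Pairwise (· > ·) := by
    rw [List.pairwise_reverse]
    exact (Finset.sortedLT_sort _).pairwise
  simp only [← hmem]
  have htop := (hmem _).mpr (length_mem_layerSizes T.length)
  have hmax : ∀ α ∈ (layerList bitlen T.length).reverse, α ≤ T.length := fun α hα =>
    le_of_mem_layerSizes ((hmem α).mp hα)
  generalize (layerList bitlen T.length).reverse = αs at *
  generalize layersDown m b = hs at *
  cases hst with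
  | nil => simp at htop
  | @cons α h αs hs hα hst =>
    obtain rfl : α = T.length := by
      rcases List.mem_cons.mp htop with h | h
      · exact h.symm
      · have h1 := (List.pairwise_cons.mp hsort).1 _ h
        have h2 := hmax α (by simp)
        omega
    obtain ⟨r₁, hrun, hr₁, hr₂⟩ := visit_runs m (Function.update r 0 h)
    obtain ⟨hl, hserve⟩ := hα.record hi
    have hL := length_pointed_length T hi
    simp only [Function.update_self, ne_eq, one_ne_zero, not_false_eq_true,
      Function.update_of_ne, OfNat.ofNat_ne_zero, hl, hr, Nat.zero_le, if_true] at hr₁ hr₂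
    obtain ⟨r', hsw, h⟩ := sweep_runs hi hst (fun α _ => length_pointed_le T α hi) _ hsort hL r₁
      (hr₁.trans hL) (hr₂ ▸ hserve)
    exact ⟨r', ⟨r₁, hrun, hsw⟩, h⟩

end Sweep

/-! ### Existence of the memory content -/

section Existence

variable {A : Type*}

/-- Address of the first word of the list, `0` if there is none. -/
def headAddr (addr : List A → ℕ) : List (List A) → ℕ
  | [] => 0
  | v :: _ => addr v

/-- Absence of repetitions makes the successor in the list a function of the word. -/
theorem exists_next_sibling (addr : List A → ℕ) {vs : List (List A)} (hvs : vs.Nodup) :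
    ∃ next : List A → ℕ, ∀ m : ℕ → ℕ, (∀ v ∈ vs, m (addr v + 5) = next v) →
      SiblingChain m addr (headAddr addr vs) vs := by
  classical
  induction vs with
  | nil => exact ⟨fun _ => 0, fun m _ => rfl⟩
  | cons x xs ih =>
    rw [List.nodup_cons] at hvs
    obtain ⟨next, hnext⟩ := ih hvs.2
    refine ⟨Function.update next x (headAddr addr xs), fun m hm => ⟨rfl, ?_⟩⟩
    rw [show headAddr addr (x :: xs) = addr x from rfl, hm x (by simp), Function.update_self]
    refine hnext m fun v hv => ?_
    rw [hm v (by simp [hv]), Function.update_of_ne]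
    rintro rfl
    exact hvs.1 hv

/-- Nodes are factors of `W`, hence among its finitely many sublists. -/
theorem exists_children (W u : List A) :
    ∃ vs : List (List A), vs.Nodup ∧ ∀ v, v ∈ vs ↔ IsChild W u v := by
  have hfin : {v | IsChild W u v}.Finite :=
    (List.finite_toSet W.sublists).subset fun v hv =>
      List.mem_sublists.mpr (IsNode.isInfix hv.2.1).sublist
  exact ⟨hfin.toFinset.toList, Finset.nodup_toList _, by simp⟩

/-- Cells of node records and of a layer record that make up a layer. -/
theorem exists_layer_cells {T : List A} {i : ℕ} (hi : i ≤ T.length) (α : ℕ) (addr : List A → ℕ)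
    (hinj : Function.Injective addr) (hnz : ∀ w, addr w ≠ 0) :
    ∃ (cell : List A → ℕ → ℕ) (lcell : ℕ → ℕ), ∀ (m : ℕ → ℕ) (h : ℕ),
      (∀ w, ∀ c < 6, m (addr w + c) = cell w c) → (∀ c < 6, m (h + c) = lcell c) →
      StoresLayer T α i m h := by
  classical
  set W := layerText T α i with hW
  set q := pointed T α i with hq
  -- Uniqueness of the parent lets the edge cells depend on `v` alone.
  have hparent : ∀ v, ∃ p l : ℕ, ∀ u, IsChild W u v → p = addr u ∧
      ∃ y, windowStart α i ≤ y ∧ y < i ∧ y + v.length ≤ layerEnd T α i ∧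
        factor T y (y + v.length) = v ∧ l = y + u.length := by
    intro v
    by_cases h : ∃ u, IsChild W u v
    · obtain ⟨u, hu⟩ := h
      obtain ⟨y, h1, h2, h3, h4⟩ := exists_early_occ hi hu.2.1.isInfix hu.ne_nil
      refine ⟨addr u, y + u.length, fun u' hu' => ?_⟩
      obtain rfl := hu.parent_unique hu'
      exact ⟨rfl, y, h1, h2, h3, h4, rfl⟩
    · exact ⟨0, 0, fun u hu => absurd ⟨u, hu⟩ h⟩
  choose par lab hpl using hparent
  choose kids hnodup hkids using exists_children W
  choose next hnext using fun u => exists_next_sibling addr (hnodup u)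
  have hsib : ∀ v, ∃ s : ℕ, ∀ u, IsChild W u v → s = next u v := by
    intro v
    by_cases h : ∃ u, IsChild W u v
    · obtain ⟨u, hu⟩ := h
      refine ⟨next u v, fun u' hu' => ?_⟩
      obtain rfl := hu.parent_unique hu'
      rfl
    · exact ⟨0, fun u hu => absurd ⟨u, hu⟩ h⟩
  choose sib hsib using hsib
  obtain ⟨u, huq, hu, hmax⟩ := exists_longest_prefix (IsNode W) (isNode_nil W) q
  have hlow : ∃ z : ℕ, (u = q ∧ z = 0) ∨
      (u ≠ q ∧ ∃ v, IsChild W u v ∧ q <+: v ∧ z = addr v) := by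
    by_cases hne : u = q
    · exact ⟨0, .inl ⟨hne, rfl⟩⟩
    · obtain ⟨v, hv, hqv⟩ := exists_child_below (pointed_isInfix hi) hu huq hne hmax
      exact ⟨addr v, .inr ⟨hne, v, hv, hqv, rfl⟩⟩
  obtain ⟨z, hz⟩ := hlow
  refine ⟨fun w c => [lab w, w.length, par w, addr w.tail, headAddr addr (kids w), sib w].getD c 0,
    fun c => [windowStart α i, layerEnd T α i, addr [], addr u, z, q.length - u.length].getD c 0,
    fun m h hm hl => ⟨addr, hinj.injOn, fun w _ => hnz w, ?_, fun w _ => ?_, fun u v huv => ?_,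
      fun c u _ => ?_, fun u _ => ⟨kids u, hnodup u, hkids u, ?_⟩, ?_, ?_, ?_, u, hu, huq, hmax,
      ?_, ?_, ?_⟩⟩
  · exact hm [] 1 (by norm_num)
  · exact hm w 1 (by norm_num)
  · obtain ⟨h1, y, h2, h3, h4, h5, h6⟩ := hpl v u huv
    exact ⟨(hm v 2 (by norm_num)).trans h1, y, h2, h3, h4, h5, (hm v 0 (by norm_num)).trans h6⟩
  · exact hm (c :: u) 3 (by norm_num)
  · rw [show m (addr u + 4) = headAddr addr (kids u) from hm u 4 (by norm_num)]
    refine hnext u m fun v hv => ?_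
    exact (hm v 5 (by norm_num)).trans (hsib v u ((hkids u v).mp hv))
  · exact hl 0 (by norm_num)
  · exact hl 1 (by norm_num)
  · exact hl 2 (by norm_num)
  · exact hl 3 (by norm_num)
  · exact hl 5 (by norm_num)
  · rw [show m (h + 4) = z from hl 4 (by norm_num)]
    exact hz

/-- Memory is laid out as header, text, layer records and node records, with six cells per record.
Every pair of a layer index and a word, node or not, gets its own record through the pairing
function, so addresses never collide. -/
theorem exists_storesMLST (code : A ↪ ℕ) (bitlen : ℕ → ℕ) {T : List A} {i : ℕ}
    (hi : i ≤ T.length) : ∃ (m : ℕ → ℕ) (b : ℕ), StoresMLST code bitlen T i m b := by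
  set αs := layerList bitlen T.length with hαs
  set N := αs.length with hN
  set H := 3 + N + T.length with hH
  set base := H + 6 * N with hbase
  let enc : List A → ℕ := fun w => Encodable.encode (w.map code)
  have henc : Function.Injective enc := fun w w' h =>
    List.map_injective_iff.mpr code.injective (Encodable.encode_injective h)
  let addr : ℕ → List A → ℕ := fun t w => base + 6 * Nat.pair t (enc w)
  have haddr : ∀ t, Function.Injective (addr t) := by
    intro t w w' h
    have h : base + 6 * Nat.pair t (enc w) = base + 6 * Nat.pair t (enc w') := h
    exact henc (Nat.pair_eq_pair.mp (by omega : Nat.pair t (enc w) = Nat.pair t (enc w'))).2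
  choose cell lcell hcell using fun t =>
    exists_layer_cells hi (αs.getD t 0) (addr t) (haddr t) (fun w => by simp only [addr]; omega)
  -- Past `base`, quotient and remainder by 6 recover record and cell; unpairing and inverting `enc`
  -- recover layer and word.
  let m : ℕ → ℕ := fun p =>
    if p = 0 then i else if p = 1 then 3 + N else if p = 2 then N
    else if p < 3 + N then H + 6 * (p - 3)
    else if p < H then (T[p - (3 + N)]?).elim 0 code
    else if p < base then lcell ((p - H) / 6) ((p - H) % 6)
    else cell (Nat.unpair ((p - base) / 6)).1
      (Function.invFun enc (Nat.unpair ((p - base) / 6)).2) ((p - base) % 6)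
  refine ⟨m, 0, ?_, fun k hk _ => ?_, ?_, fun t ht => ?_⟩
  · simp [m]
  · have h1 : m (0 + 1) = 3 + N := by simp [m]
    rw [h1]
    simp only [m]
    rw [if_neg (by omega), if_neg (by omega), if_neg (by omega), if_neg (by omega),
      if_pos (by omega), Nat.add_sub_cancel_left, List.getElem?_eq_getElem hk]
    rfl
  · simp [m]
    rfl
  · have ht' : t < N := ht
    have h1 : m (0 + 3 + t) = H + 6 * t := by
      simp only [m]
      rw [if_neg (by omega), if_neg (by omega), if_neg (by omega), if_pos (by omega)]
      omega
    rw [h1, show (layerList bitlen T.length)[t] = αs.getD t 0 by simp [αs, ht]]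
    refine hcell t m _ (fun w c hc => ?_) fun c hc => ?_
    · have h2 : (addr t w + c - base) / 6 = Nat.pair t (enc w) := by simp only [addr]; omega
      have h3 : (addr t w + c - base) % 6 = c := by simp only [addr]; omega
      have h4 : base ≤ addr t w + c := by simp only [addr]; omega
      simp only [m]
      rw [if_neg (by omega), if_neg (by omega), if_neg (by omega), if_neg (by omega),
        if_neg (by omega), if_neg (by omega), h2, h3, Nat.unpair_pair]
      simp only [Function.leftInverse_invFun henc w]
    · have h2 : (H + 6 * t + c - H) / 6 = t := by omega
      have h3 : (H + 6 * t + c - H) % 6 = c := by omega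
      simp only [m]
      rw [if_neg (by omega), if_neg (by omega), if_neg (by omega), if_neg (by omega),
        if_neg (by omega), if_pos (by omega), h2, h3]

end Existence

end MLST

theorem mainTheorem2 :
    ∃ (reset visit query : Program) (C : ℕ),
      ∀ {A : Type*} (code : A ↪ ℕ) (bitlen : ℕ → ℕ) (_ : Monotone bitlen) (T : List A) (i : ℕ)
        (_ : i ≤ T.length),
        (∀ α ∈ layerSizes bitlen T.length,
          layerEnd T α i = i + lpfFrom T (windowStart α i) i) ∧
        T.length ∈ layerSizes bitlen T.length ∧
        layerEnd T T.length i = i + lpf T i ∧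
        (∃ (m : ℕ → ℕ) (b : ℕ), StoresMLST code bitlen T i m b) ∧
        ∀ (m : ℕ → ℕ) (b : ℕ) (_ : StoresMLST code bitlen T i m b) (r : ℕ → ℕ),
          ∃ r₁ r₂ r₃ : ℕ → ℕ,
            RunsWithin reset C m r r₁ ∧
            SweepsWithin visit C m (layersDown m b) r₁ r₂ ∧
            RunsWithin query C m r₂ r₃ ∧
            IsREP bitlen T i (lpfWord T i) (r₃ 0) ∧
            ∃ α ∈ layerSizes bitlen T.length,
              (pointed T α i).length = lpf T i ∧
              (∀ β ∈ layerSizes bitlen T.length, β < α → (pointed T β i).length < lpf T i) ∧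
              (0 < i → windowStart α i ≤ r₃ 0 ∧ r₃ 0 ∈ prevPos T i (lpfWord T i)) := by
  refine ⟨resetProgram, visitProgram, queryProgram, 30, fun {A} code bitlen hb T i hi =>
    ⟨fun α _ => layerEnd_eq T α hi, length_mem_layerSizes T.length, ?_,
      exists_storesMLST code bitlen hi, fun m b h r => ?_⟩⟩
  · rw [layerEnd_eq T _ hi, windowStart_length T hi, lpf]
  · obtain ⟨r₁, hr₁, h0⟩ := reset_runs m r
    obtain ⟨r₂, hr₂, α, hα, hlen, hserve, hmin⟩ := h.building_runs hi r₁ h0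
    obtain ⟨r₃, hr₃, h3⟩ := query_runs m r₂
    rw [← h3] at hserve
    exact ⟨r₁, r₂, r₃, hr₁, hr₂, hr₃, isREP_of_smallest hb hi hlen hserve hmin, α, hα, hlen, hmin,
      fun hpos => ⟨(hserve.1 hpos).1, hserve.mem_prevPos hi hlen hpos⟩⟩
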